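/- Let $j$ be a positive integer and let $f(x)$ be one of the functions $e^{x^j}$, $\sin x$, $\cos x$, $\tan x$, $\csc x$, $\sec x$, $\cot x$, $\sinh x$, $\cosh x$, $\tanh x$, $\coth x$ of a complex variable $x$. Let $g \in \mathbb{Q}[X]$ be a polynomial with $1 \le \deg g \le 4$, and let $h \in \mathbb{Q}[X]$. If $\alpha \in \mathbb{C}$ is a non-zero solution of the equation $g(f(x)) = h(x)$ (in particular, $f$ is defined at $\alpha$) such that $g(f(\alpha))$, $f(\alpha)$ and $h(\alpha)$ are all non-zero, then $\alpha$ is transcendental over $\mathbb{Q}$. -/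

import Mathlib

open Polynomial

/-- The complex secant `1 / cos z`. At a pole it takes the junk value `0`. -/
noncomputable def csec (z : ℂ) : ℂ := 1 / Complex.cos z

/-- The complex cosecant `1 / sin z`. At a pole it takes the junk value `0`. -/
noncomputable def ccsc (z : ℂ) : ℂ := 1 / Complex.sin z

/-- The complex hyperbolic cotangent `cosh z / sinh z`. At a pole it takes the junk value `0`. -/
noncomputable def ccoth (z : ℂ) : ℂ := Complex.cosh z / Complex.sinh z

/-- The eleven functions `e^{x^j}`, `sin`, `cos`, `tan`, `csc`, `sec`, `cot`, `sinh`, `cosh`,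
`tanh`, `coth`, as functions of a complex variable. On the reals they restrict to the usual real
functions. Those with poles take the value `0` there, so that `f z ≠ 0` implies that `f` is
defined at `z`. -/
noncomputable def elementaryFunctions (j : ℕ) : Set (ℂ → ℂ) :=
  {fun z => Complex.exp (z ^ j), Complex.sin, Complex.cos, Complex.tan, ccsc, csec, Complex.cot,
    Complex.sinh, Complex.cosh, Complex.tanh, ccoth}

/-! If `α` were algebraic, then `h(α)` would be, and so would `f(α)`, a root of the nonconstant
polynomial `g - h(α)`. This contradicts Hermite–Lindemann, extended from `exp` to the other
functions by algebraic identities.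

For Hermite–Lindemann, a relation `B(e^α) = 0` is a nonzero element of the group ring `ℤ[K]`, `K` a
Galois number field containing `α`, killed by `[x] ↦ e^x`. Norm and translation make it Galois
invariant with nonzero constant coefficient. Hermite's approximations of the `e^x` by `(p / n)
g(x)`, for a large prime `p`, then yield an integer that is smaller than 1 yet not divisible by `p`.
-/

/-- A nonzero element algebraic over `ℤ` is a root of an integer polynomial which does not vanish
at `0`. -/
theorem exists_int_poly_eval_zero_ne_zero {K : Type*} [Field K] [CharZero K] {x : K}
    (hx : IsAlgebraic ℤ x) (hx0 : x ≠ 0) : ∃ f : ℤ[X], f.eval 0 ≠ 0 ∧ aeval x f = 0 := by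
  obtain ⟨p, hp0, hp⟩ := hx
  obtain ⟨q, hq, hdvd⟩ := p.exists_eq_pow_rootMultiplicity_mul_and_not_dvd hp0 0
  refine ⟨q, fun h => hdvd (dvd_iff_isRoot.2 h), ?_⟩
  rw [hq] at hp
  simpa [hx0] using hp

theorem exists_int_poly_of_finset {K : Type*} [Field K] [CharZero K] [Algebra.IsAlgebraic ℤ K]
    (S : Finset K) (hS : ∀ x ∈ S, x ≠ 0) :
    ∃ f : ℤ[X], f.eval 0 ≠ 0 ∧ ∀ x ∈ S, aeval x f = 0 := by
  have h (x : K) (hx : x ∈ S) := exists_int_poly_eval_zero_ne_zero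
    (Algebra.IsAlgebraic.isAlgebraic (R := ℤ) x) (hS x hx)
  choose! q hq0 hq using h
  refine ⟨∏ x ∈ S, q x, ?_, fun x hx => ?_⟩
  · rw [eval_prod]
    exact Finset.prod_ne_zero_iff.2 hq0
  · rw [map_prod]
    exact Finset.prod_eq_zero hx (hq x hx)

theorem isIntegral_pow_leadingCoeff_mul_aeval {K : Type*} [Field K] {f g : ℤ[X]} {x : K}
    (hx : aeval x f = 0) {N : ℕ} (hN : g.natDegree ≤ N) :
    IsIntegral ℤ ((f.leadingCoeff : K) ^ N * aeval x g) := by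
  have hax : IsIntegral ℤ ((f.leadingCoeff : K) * x) := by
    simpa using isIntegral_leadingCoeff_smul f x hx
  have ha : IsIntegral ℤ (f.leadingCoeff : K) := isIntegral_algebraMap (x := f.leadingCoeff)
  rw [aeval_eq_sum_range, Finset.mul_sum]
  refine IsIntegral.sum _ fun i hi => ?_
  have hi' : i ≤ N := (Nat.lt_succ_iff.1 (Finset.mem_range.1 hi)).trans hN
  have : (f.leadingCoeff : K) ^ N * g.coeff i • x ^ i =
      g.coeff i • ((f.leadingCoeff : K) ^ (N - i) * ((f.leadingCoeff : K) * x) ^ i) := by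
    rw [← Nat.sub_add_cancel hi', pow_add]
    simp
    ring
  rw [this]
  exact ((ha.pow _).mul (hax.pow _)).smul _

theorem exists_int_eq_of_isIntegral_of_fixed {K : Type*} [Field K] [Algebra ℚ K]
    [FiniteDimensional ℚ K] [IsGalois ℚ K] {x : K} (hx : IsIntegral ℤ x)
    (h : ∀ σ : K ≃ₐ[ℚ] K, σ x = x) : ∃ t : ℤ, (t : K) = x := by
  obtain ⟨q, rfl⟩ := IntermediateField.mem_bot.1 ((IsGalois.mem_bot_iff_fixed x).2 h)
  have hq : IsIntegral ℤ q :=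
    (isIntegral_algebraMap_iff (algebraMap ℚ K).injective).1 hx
  obtain ⟨t, rfl⟩ := IsIntegrallyClosed.isIntegral_iff.1 hq
  exact ⟨t, by simp⟩

theorem eventually_mul_pow_div_factorial_pred_lt_one (C c : ℝ) :
    ∀ᶠ p : ℕ in Filter.atTop, C * (c ^ p / ((p - 1).factorial : ℝ)) < 1 := by
  have h := ((FloorSemiring.tendsto_pow_div_factorial_atTop c).const_mul (C * c)).comp
    (Filter.tendsto_sub_atTop_nat 1)
  rw [mul_zero] at h
  filter_upwards [h.eventually (gt_mem_nhds one_pos), Filter.eventually_ge_atTop 1] with p hp h1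
  refine lt_of_eq_of_lt ?_ hp
  obtain ⟨q, rfl⟩ := Nat.exists_eq_add_of_le' h1
  simp only [Function.comp_apply, Nat.add_sub_cancel, pow_succ]
  ring

/-- A Galois invariant integral combination of exponentials of elements of a number field, with
nonzero constant coefficient, does not vanish. -/
theorem sum_mul_exp_ne_zero_of_invariant {K : Type*} [Field K] [Algebra ℚ K]
    [FiniteDimensional ℚ K] [IsGalois ℚ K] (φ : K →+* ℂ) (H : K →₀ ℤ)
    (hinv : ∀ (σ : K ≃ₐ[ℚ] K) x, H (σ x) = H x) (h0 : H 0 ≠ 0) :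
    (H.sum fun x c => (c : ℂ) * Complex.exp (φ x)) ≠ 0 := by
  classical
  intro hsum
  have : CharZero K := algebraRat.charZero K
  have : Algebra.IsAlgebraic ℤ K :=
    (IsFractionRing.comap_isAlgebraic_iff (A := ℤ) (K := ℚ) (C := K)).2 inferInstance
  set S := H.support.erase 0 with hS
  obtain ⟨f, hf0, hfS⟩ := exists_int_poly_of_finset S (fun x hx => Finset.ne_of_mem_erase hx)
  have hfne : f ≠ 0 := by rintro rfl; simp at hf0
  obtain ⟨c, hc⟩ := LindemannWeierstrass.exp_polynomial_approx f hf0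
  set a := f.leadingCoeff with ha
  have ha0 : a ≠ 0 := leadingCoeff_ne_zero.2 hfne
  set d := f.natDegree with hd
  set C : ℝ := ∑ x ∈ S, |(H x : ℝ)| with hC
  -- The first condition keeps the error below 1 after multiplication by `a ^ (p * d)`; `p > |f(0)|`
  -- is needed for the approximation; the other two make `p` divide neither `a` nor `H 0`.
  obtain ⟨p, ⟨hp1, hpf, hpa, hpH⟩, hp⟩ := (((eventually_mul_pow_div_factorial_pred_lt_one C
    (|(a : ℝ)| ^ d * c)).and ((Filter.eventually_gt_atTop (eval 0 f).natAbs).and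
      ((Filter.eventually_gt_atTop a.natAbs).and
        (Filter.eventually_gt_atTop (H 0).natAbs)))).and_frequently
    (Nat.frequently_atTop_iff_infinite.2 Nat.infinite_setOfPred_prime)).exists
  obtain ⟨n, hpn, g, hgdeg, hg⟩ := hc p hpf hp
  set T : K := ∑ x ∈ S, (H x : K) * aeval x g with hT
  have hTσ (σ : K ≃ₐ[ℚ] K) : σ T = T := by
    rw [hT, map_sum]
    refine Finset.sum_equiv σ.toEquiv (fun x => ?_) (fun x hx => ?_)
    · simp [hS, hinv]
    · have : σ (aeval x g) = aeval (σ x) g :=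
        (aeval_algHom_apply (σ.toAlgHom.restrictScalars ℤ) x g).symm
      simp [hinv, this]
  have hTint : IsIntegral ℤ ((a : K) ^ (p * d) * T) := by
    rw [hT, Finset.mul_sum]
    refine IsIntegral.sum _ fun x hx => ?_
    rw [mul_left_comm]
    exact (isIntegral_algebraMap (x := H x)).mul
      (isIntegral_pow_leadingCoeff_mul_aeval (hfS x hx) (hgdeg.trans (Nat.sub_le _ _)))
  obtain ⟨t, ht⟩ := exists_int_eq_of_isIntegral_of_fixed hTint (fun σ => by simp [hTσ])
  have hsplit : (H 0 : ℂ) + ∑ x ∈ S, (H x : ℂ) * Complex.exp (φ x) = 0 := by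
    rw [← hsum, Finsupp.sum, ← Finset.add_sum_erase _ _ (Finsupp.mem_support_iff.2 h0)]
    simp [hS]
  have hφT : φ T = ∑ x ∈ S, (H x : ℂ) * aeval (φ x) g := by
    rw [hT, map_sum]
    refine Finset.sum_congr rfl fun x _ => ?_
    have : φ (aeval x g) = aeval (φ x) g := (aeval_algHom_apply φ.toIntAlgHom x g).symm
    simp [this]
  -- Subtracting `n` times the vanishing relation leaves only approximation errors.
  have herr : (n : ℂ) * H 0 + p * φ T =
      -∑ x ∈ S, (H x : ℂ) * (n • Complex.exp (φ x) - p • aeval (φ x) g) := by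
    rw [hφT, eq_neg_iff_add_eq_zero, ← mul_zero (n : ℂ), ← hsplit, mul_add, add_assoc,
      Finset.mul_sum, Finset.mul_sum, ← Finset.sum_add_distrib]
    congr 1
    refine Finset.sum_congr rfl fun x _ => ?_
    simp
    ring
  have hbound : ‖(n : ℂ) * H 0 + p * φ T‖ ≤ C * (c ^ p / ((p - 1).factorial : ℝ)) := by
    rw [herr, norm_neg, hC, Finset.sum_mul]
    refine (norm_sum_le _ _).trans (Finset.sum_le_sum fun x hx => ?_)
    rw [norm_mul, Complex.norm_intCast]
    refine mul_le_mul_of_nonneg_left (hg ?_) (abs_nonneg _)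
    rw [mem_aroots]
    refine ⟨hfne, ?_⟩
    have : φ (aeval x f) = aeval (φ x) f := (aeval_algHom_apply φ.toIntAlgHom x f).symm
    rw [← this, hfS x hx, map_zero]
  have hφt : (a : ℂ) ^ (p * d) * φ T = t := by
    simpa using (congrArg φ ht).symm
  have hlt : ‖((a ^ (p * d) * (n * H 0) + p * t : ℤ) : ℂ)‖ < 1 := by
    have : ((a ^ (p * d) * (n * H 0) + p * t : ℤ) : ℂ) =
        (a : ℂ) ^ (p * d) * ((n : ℂ) * H 0 + p * φ T) := by
      push_cast
      rw [← hφt]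
      ring
    rw [this, norm_mul, norm_pow, Complex.norm_intCast]
    refine (mul_le_mul_of_nonneg_left hbound (by positivity)).trans_lt (lt_of_eq_of_lt ?_ hp1)
    rw [mul_pow, mul_comm p d, pow_mul]
    ring
  have hzero : a ^ (p * d) * (n * H 0) + p * t = 0 := by
    rw [Complex.norm_intCast] at hlt
    exact Int.abs_lt_one_iff.1 (by exact_mod_cast hlt)
  have hdvd : (p : ℤ) ∣ a ^ (p * d) * (n * H 0) :=
    ⟨-t, by linear_combination hzero⟩
  have hpZ : Prime (p : ℤ) := Nat.prime_iff_prime_int.1 hp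
  have hsmall {m : ℤ} (hm0 : m ≠ 0) (hm : m.natAbs < p) : ¬ (p : ℤ) ∣ m := fun h =>
    (Nat.le_of_dvd (Int.natAbs_pos.2 hm0) (Int.natCast_dvd.1 h)).not_gt hm
  rcases hpZ.dvd_or_dvd hdvd with h | h
  · exact hsmall ha0 hpa (hpZ.dvd_of_dvd_pow h)
  · exact (hpZ.dvd_or_dvd h).elim hpn (hsmall h0 hpH)

/-! ### The group ring of `K` and its Galois action -/

/-- Evaluation of the group ring element `∑ cₓ [x]` at `∑ cₓ exp (φ x)`. -/
noncomputable def expEval {K : Type*} [Field K] (φ : K →+* ℂ) : AddMonoidAlgebra ℤ K →ₐ[ℤ] ℂ :=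
  AddMonoidAlgebra.lift ℤ ℂ K
    (Complex.expMonoidHom.comp (AddMonoidHom.toMultiplicative (φ : K →+ ℂ)))

theorem expEval_apply {K : Type*} [Field K] (φ : K →+* ℂ) (F : AddMonoidAlgebra ℤ K) :
    expEval φ F = F.coeff.sum fun x c => (c : ℂ) * Complex.exp (φ x) := rfl

theorem expEval_single {K : Type*} [Field K] (φ : K →+* ℂ) (x : K) (c : ℤ) :
    expEval φ (AddMonoidAlgebra.single x c) = c * Complex.exp (φ x) := by
  rw [expEval_apply, AddMonoidAlgebra.coeff_single, Finsupp.sum_single_index (by simp)]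

/-- The action of a field automorphism on the group ring of the additive group. -/
noncomputable def galAct {K : Type*} [Field K] [Algebra ℚ K] (σ : K ≃ₐ[ℚ] K) :
    AddMonoidAlgebra ℤ K →+* AddMonoidAlgebra ℤ K :=
  AddMonoidAlgebra.mapDomainRingHom ℤ (σ : K →+ K)

theorem coeff_galAct {K : Type*} [Field K] [Algebra ℚ K] (σ : K ≃ₐ[ℚ] K)
    (F : AddMonoidAlgebra ℤ K) (x : K) : (galAct σ F).coeff (σ x) = F.coeff x :=
  Finsupp.mapDomain_apply σ.injective F.coeff x

theorem galAct_single {K : Type*} [Field K] [Algebra ℚ K] (σ : K ≃ₐ[ℚ] K) (x : K) (c : ℤ) :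
    galAct σ (AddMonoidAlgebra.single x c) = AddMonoidAlgebra.single (σ x) c :=
  AddMonoidAlgebra.mapDomain_single

theorem galAct_mul {K : Type*} [Field K] [Algebra ℚ K] (σ τ : K ≃ₐ[ℚ] K)
    (F : AddMonoidAlgebra ℤ K) : galAct (σ * τ) F = galAct σ (galAct τ F) := by
  ext x
  obtain ⟨y, rfl⟩ := (σ * τ).surjective x
  rw [coeff_galAct, AlgEquiv.mul_apply, coeff_galAct, coeff_galAct]

theorem galAct_one {K : Type*} [Field K] [Algebra ℚ K] (F : AddMonoidAlgebra ℤ K) :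
    galAct 1 F = F := by
  ext x
  exact coeff_galAct 1 F x

theorem galAct_ne_zero {K : Type*} [Field K] [Algebra ℚ K] (σ : K ≃ₐ[ℚ] K)
    {F : AddMonoidAlgebra ℤ K} (hF : F ≠ 0) : galAct σ F ≠ 0 := fun h => hF <| by
  rw [← galAct_one F, ← inv_mul_cancel σ, galAct_mul, h, map_zero]

/-- The exponentials of the elements of a number field are linearly independent over `ℤ`. -/
theorem expEval_ne_zero {K : Type*} [Field K] [Algebra ℚ K] [FiniteDimensional ℚ K]
    [IsGalois ℚ K] (φ : K →+* ℂ) {F : AddMonoidAlgebra ℤ K} (hF : F ≠ 0) : expEval φ F ≠ 0 := by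
  classical
  intro hev
  set N := ∏ σ : K ≃ₐ[ℚ] K, galAct σ F with hN
  -- The group ring has no zero divisors.
  have hN0 : N ≠ 0 := Finset.prod_ne_zero_iff.2 fun σ _ => galAct_ne_zero σ hF
  have hNσ (τ : K ≃ₐ[ℚ] K) : galAct τ N = N := by
    rw [hN, map_prod]
    exact Fintype.prod_equiv (Equiv.mulLeft τ) _ _ fun σ => (galAct_mul τ σ F).symm
  have hNev : expEval φ N = 0 := by
    rw [hN, map_prod]
    exact Finset.prod_eq_zero (Finset.mem_univ 1) (by rw [galAct_one, hev])
  have hNinv (τ : K ≃ₐ[ℚ] K) (x : K) : N.coeff (τ x) = N.coeff x := by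
    conv_lhs => rw [← hNσ τ]
    exact coeff_galAct τ N x
  obtain ⟨y, hy⟩ : ∃ y, N.coeff y ≠ 0 := by
    by_contra! h
    exact hN0 (by ext x; simpa using h x)
  -- Translating by the whole orbit of `-y` keeps invariance, and each translate contributes the
  -- same `N.coeff y` at 0, so nothing cancels.
  set M := N * ∑ σ : K ≃ₐ[ℚ] K, AddMonoidAlgebra.single (-σ y) (1 : ℤ) with hM
  have hMσ (τ : K ≃ₐ[ℚ] K) : galAct τ M = M := by
    rw [hM, map_mul, hNσ, map_sum]
    congr 1
    refine Fintype.sum_equiv (Equiv.mulLeft τ) _ _ fun σ => ?_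
    rw [galAct_single]
    simp
  have hMinv (τ : K ≃ₐ[ℚ] K) (x : K) : M.coeff (τ x) = M.coeff x := by
    conv_lhs => rw [← hMσ τ]
    exact coeff_galAct τ M x
  have hM0 : M.coeff 0 = Fintype.card (K ≃ₐ[ℚ] K) * N.coeff y := by
    have (σ : K ≃ₐ[ℚ] K) : (N * AddMonoidAlgebra.single (-σ y) (1 : ℤ)).coeff 0 = N.coeff y := by
      rw [← hNinv σ y, AddMonoidAlgebra.coeff_mul_single_eq_coeff_mul (m₂ := σ y), mul_one]
      intro a _
      exact ⟨fun h => by linear_combination h, fun h => by rw [h]; simp⟩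
    rw [hM, Finset.mul_sum, AddMonoidAlgebra.coeff_sum, Finsupp.finsetSum_apply]
    simp [this]
  refine sum_mul_exp_ne_zero_of_invariant φ M.coeff hMinv ?_ ?_
  · rw [hM0]
    exact mul_ne_zero (by exact_mod_cast Fintype.card_ne_zero) hy
  · rw [← expEval_apply, hM, map_mul, hNev, zero_mul]

theorem aeval_exp_ne_zero {K : Type*} [Field K] [Algebra ℚ K] [FiniteDimensional ℚ K]
    [IsGalois ℚ K] (φ : K →+* ℂ) {x : K} (hx : x ≠ 0) {B : ℤ[X]} (hB : B ≠ 0) :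
    aeval (Complex.exp (φ x)) B ≠ 0 := by
  classical
  have : CharZero K := algebraRat.charZero K
  set F : AddMonoidAlgebra ℤ K := aeval (AddMonoidAlgebra.single x 1) B with hF
  have hFsum : F = ∑ i ∈ Finset.range (B.natDegree + 1),
      AddMonoidAlgebra.single ((i : K) * x) (B.coeff i) := by
    rw [hF, aeval_eq_sum_range]
    refine Finset.sum_congr rfl fun i _ => ?_
    simp [AddMonoidAlgebra.single_pow]
  -- The exponents `i * x` are distinct, so the leading coefficient of `B` survives.
  have hF0 : F ≠ 0 := fun h => by
    have h1 := congrArg (fun G => G.coeff ((B.natDegree : K) * x)) h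
    rw [hFsum] at h1
    simp [Finsupp.single_apply, hx, hB] at h1
  have hev := expEval_ne_zero φ hF0
  rw [hF, ← aeval_algHom_apply, expEval_single] at hev
  simpa using hev

/-- **Hermite–Lindemann theorem**: the exponential of a nonzero algebraic number is
transcendental. -/
theorem transcendental_exp_of_isAlgebraic {α : ℂ} (hα : α ≠ 0) (halg : IsAlgebraic ℚ α) :
    Transcendental ℚ (Complex.exp α) := by
  intro hexp
  obtain ⟨B, hB0, hB⟩ := (IsFractionRing.isAlgebraic_iff ℤ ℚ ℂ).2 hexp
  let K := IntermediateField.adjoin ℚ ((minpoly ℚ α).rootSet ℂ)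
  have hK : (minpoly ℚ α).IsSplittingField ℚ K :=
    IntermediateField.adjoin_rootSet_isSplittingField (IsAlgClosed.splits _)
  have : FiniteDimensional ℚ K := IsSplittingField.finiteDimensional K (minpoly ℚ α)
  have : Normal ℚ K := Normal.of_isSplittingField (minpoly ℚ α)
  have : IsGalois ℚ K := IsGalois.mk
  have hmem : α ∈ K := IntermediateField.subset_adjoin _ _
    (mem_rootSet.2 ⟨minpoly.ne_zero halg.isIntegral, minpoly.aeval ℚ α⟩)
  exact aeval_exp_ne_zero (algebraMap K ℂ) (x := ⟨α, hmem⟩) (fun h => hα (congrArg Subtype.val h))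
    hB0 hB

/-! ### Trigonometric and hyperbolic functions -/

theorem isAlgebraic_I : IsAlgebraic ℚ Complex.I :=
  IsAlgebraic.of_pow two_pos (by rw [Complex.I_sq]; exact isAlgebraic_one.neg)

theorem transcendental_sinh {z : ℂ} (hz : z ≠ 0) (halg : IsAlgebraic ℚ z) :
    Transcendental ℚ (Complex.sinh z) := by
  intro h
  have hc : IsAlgebraic ℚ (Complex.cosh z) :=
    IsAlgebraic.of_pow two_pos (by rw [Complex.cosh_sq]; exact (h.pow 2).add isAlgebraic_one)
  exact transcendental_exp_of_isAlgebraic hz halg (Complex.cosh_add_sinh z ▸ hc.add h)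

theorem transcendental_cosh {z : ℂ} (hz : z ≠ 0) (halg : IsAlgebraic ℚ z) :
    Transcendental ℚ (Complex.cosh z) := by
  intro h
  refine transcendental_sinh hz halg (IsAlgebraic.of_pow two_pos ?_)
  rw [Complex.sinh_sq]
  exact (h.pow 2).sub isAlgebraic_one

theorem transcendental_tanh {z : ℂ} (halg : IsAlgebraic ℚ z) (ht : Complex.tanh z ≠ 0) :
    Transcendental ℚ (Complex.tanh z) := by
  intro h
  have hz : z ≠ 0 := by rintro rfl; simp at ht
  -- At a pole `tanh` has the default value 0, so `ht` excludes poles.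
  have hc : Complex.cosh z ≠ 0 := fun hc => ht (by rw [Complex.tanh_eq_sinh_div_cosh, hc, div_zero])
  refine transcendental_cosh hz halg (IsAlgebraic.of_pow two_pos (IsAlgebraic.inv_iff.1 ?_))
  have : (Complex.cosh z ^ 2)⁻¹ = 1 - Complex.tanh z ^ 2 := by
    rw [Complex.tanh_eq_sinh_div_cosh]
    field_simp
    rw [Complex.cosh_sq]
    ring
  rw [this]
  exact isAlgebraic_one.sub (h.pow 2)

theorem transcendental_sin {z : ℂ} (hz : z ≠ 0) (halg : IsAlgebraic ℚ z) :
    Transcendental ℚ (Complex.sin z) := fun h =>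
  transcendental_sinh (mul_ne_zero hz Complex.I_ne_zero) (halg.mul isAlgebraic_I)
    (Complex.sinh_mul_I z ▸ h.mul isAlgebraic_I)

theorem transcendental_cos {z : ℂ} (hz : z ≠ 0) (halg : IsAlgebraic ℚ z) :
    Transcendental ℚ (Complex.cos z) := fun h =>
  transcendental_cosh (mul_ne_zero hz Complex.I_ne_zero) (halg.mul isAlgebraic_I)
    (Complex.cosh_mul_I z ▸ h)

theorem transcendental_tan {z : ℂ} (halg : IsAlgebraic ℚ z) (ht : Complex.tan z ≠ 0) :
    Transcendental ℚ (Complex.tan z) := fun h =>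
  transcendental_tanh (halg.mul isAlgebraic_I)
    (Complex.tanh_mul_I z ▸ mul_ne_zero ht Complex.I_ne_zero)
    (Complex.tanh_mul_I z ▸ h.mul isAlgebraic_I)

/-- Each of the elementary functions takes transcendental values at nonzero algebraic points that
are neither zeros nor poles. -/
theorem transcendental_of_mem_elementaryFunctions {j : ℕ} {f : ℂ → ℂ}
    (hf : f ∈ elementaryFunctions j) {z : ℂ} (hz : z ≠ 0) (halg : IsAlgebraic ℚ z)
    (hfz : f z ≠ 0) : Transcendental ℚ (f z) := by
  have inv {x y : ℂ} (hxy : x = y⁻¹) (hy : Transcendental ℚ y) : Transcendental ℚ x :=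
    fun h => hy (IsAlgebraic.inv_iff.1 (hxy ▸ h))
  rcases hf with rfl | rfl | rfl | rfl | rfl | rfl | rfl | rfl | rfl | rfl | rfl
  · exact transcendental_exp_of_isAlgebraic (pow_ne_zero j hz) (halg.pow j)
  · exact transcendental_sin hz halg
  · exact transcendental_cos hz halg
  · exact transcendental_tan halg hfz
  · exact inv (one_div _) (transcendental_sin hz halg)
  · exact inv (one_div _) (transcendental_cos hz halg)
  · have h : Complex.cot z = (Complex.tan z)⁻¹ := by
      rw [Complex.tan_eq_sin_div_cos, inv_div, Complex.cot]
    exact inv h (transcendental_tan halg (fun h0 => hfz (by rw [h, h0, inv_zero])))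
  · exact transcendental_sinh hz halg
  · exact transcendental_cosh hz halg
  · exact transcendental_tanh halg hfz
  · have h : ccoth z = (Complex.tanh z)⁻¹ := by
      rw [Complex.tanh_eq_sinh_div_cosh, inv_div, ccoth]
    exact inv h (transcendental_tanh halg (fun h0 => hfz (by rw [h, h0, inv_zero])))

theorem corollary5 (j : ℕ) (hj : 0 < j) (f : ℂ → ℂ) (hf : f ∈ elementaryFunctions j)
    (g h : ℚ[X]) (hg_one : 1 ≤ g.natDegree) (hg_four : g.natDegree ≤ 4)
    (α : ℂ) (hα : α ≠ 0) (hsol : aeval (f α) g = aeval α h)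
    (hgf : aeval (f α) g ≠ 0) (hfα : f α ≠ 0) (hhα : aeval α h ≠ 0) :
    Transcendental ℚ α := by
  intro halg
  refine transcendental_of_mem_elementaryFunctions hf hα halg hfα ?_
  have hg : g ≠ 0 := by rintro rfl; simp at hg_one
  -- As `g` is nonconstant, algebraicity of `g(f(α))` descends to `f(α)`.
  refine IsAlgebraic.of_aeval g (by omega)
    (mem_nonZeroDivisors_of_ne_zero (leadingCoeff_ne_zero.2 hg)) ?_
  rw [hsol]
  rw [aeval_eq_sum_range]
  exact (IsIntegral.sum _ fun i _ => (halg.isIntegral.pow i).smul (h.coeff i)).isAlgebraic
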